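/- **Setting.** Let $P$ be a finite set of $n=|P|$ points with a similarity $\mu:P\times P\to\mathbb R$. For each $p\in P$ fix a nearest neighbor ordering, i.e. a bijection $\pi_p:\{1,\dots,n\}\to P$ with $\mu(p,\pi_p(1))\ge\mu(p,\pi_p(2))\ge\dots\ge\mu(p,\pi_p(n))$ (ties broken arbitrarily), and for $1\le k\le n$ put $\tau_k(p)=\mu(p,\pi_p(k))$ and $s_k(p)=1-\tau_k(p)$. A hash family $\mathcal H$ is a probability distribution over functions $h:P\to U$; $h_1,h_2,\dots$ denote independent draws from $\mathcal H$. For $\rho\ge 0$ and $L\ge 0$, a collection $(\mathcal A_p)_{p\in P}$ of subsets of $P$ is a *$(k,\rho,L)$-ANN family with respect to $\mathcal H$* if for every $p\in P$: * $\mathcal A_p=\{\pi_p(1),\dots,\pi_p(m)\}$ for some $m$ with $k\le m\le n$; * there is an integer $\ell=\ell(p)$ with $0\le \ell\le L$ such that $\Pr[(h_1(p),\dots,h_\ell(p))=(h_1(\pi_p(i)),\dots,h_\ell(\pi_p(i)))]\ge n^{-\rho}$ for all $1\le i\le k$, and $\Pr[(h_1(p),\dots,h_\ell(p))=(h_1(x),\dots,h_\ell(x))]\le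 n^{-4}$ for all $x\in P\setminus\mathcal A_p$. For $\varepsilon\in(0,1)$ and real $M\ge1$ let $$\mathcal A_p=\{x\in P:\ \mu(p,x)\ge\min\{1-\varepsilon^{-1}s_k(p),\,1-1/M\}\}.$$ **Proposition.** For every $\varepsilon_0<1$ there is a constant $C>0$, depending only on $\varepsilon_0$, such that for all $\varepsilon\in(0,\varepsilon_0]$ and all real $M\ge 1$ the following hold ($\log$ is the natural logarithm). 1. (Angular similarity, SimHash.) Let $d\ge1$, let $P\subset\mathbb R^d\setminus\{0\}$ be finite with $n=|P|$, and let $\mu(x,y)=1-\theta_{x,y}$, where $\theta_{x,y}\in[0,1]$ is the angle between $x$ and $y$ divided by $\pi$. Let $\mathcal H$ be the SimHash family: $h(x)=\operatorname{sign}\langle x,z\rangle$ with $z$ uniform on the unit sphere of $\mathbb R^d$. Then, for every choice of nearest neighbor orderings and every $1\le k\le n$, the sets $(\mathcal A_p)_{p\in P}$ form a $(k,\,C\varepsilon,\,4M\log n)$-ANN family with respect to $\mathcal H$. 2. (Jaccard similarity, MinHash.) Let $P$ be a finite set, $n=|P|$, of nonempty finite subsets of a (possibly infinite) universe $\mathcal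 U$, and let $\mu(x,y)=|x\cap y|/|x\cup y|$. Let $\mathcal H$ be the MinHash family: $h(x)=\min_{u\in x}n_u$ with $(n_u)_{u\in\mathcal U}$ independent and uniform on $[0,1]$. Then, for every choice of nearest neighbor orderings and every $1\le k\le n$, the sets $(\mathcal A_p)_{p\in P}$ form a $(k,\,C\varepsilon,\,4M\log n)$-ANN family with respect to $\mathcal H$. -/

import Mathlib

open MeasureTheory

noncomputable section

/-- The angular similarity `1 - θ` of two vectors, where `θ ∈ [0, 1]` is the angle between them
divided by `π`. (The angle is a meaningful notion for nonzero vectors only.) -/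
def angularSim {d : ℕ} (x y : EuclideanSpace ℝ (Fin d)) : ℝ :=
  1 - InnerProductGeometry.angle x y / Real.pi

/-- The Jaccard similarity `|x ∩ y| / |x ∪ y|` of two finite sets.
(Meaningful unless both sets are empty.) -/
def jaccardSim {𝒰 : Type*} [DecidableEq 𝒰] (x y : Finset 𝒰) : ℝ :=
  ((x ∩ y).card : ℝ) / ((x ∪ y).card : ℝ)

/-- The uniform probability distribution on the unit sphere of `ℝ^d`: the normalized surface
measure. -/
def sphereUniform (d : ℕ) : Measure (Metric.sphere (0 : EuclideanSpace ℝ (Fin d)) 1) :=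
  ((volume : Measure (EuclideanSpace ℝ (Fin d))).toSphere Set.univ)⁻¹ •
    (volume : Measure (EuclideanSpace ℝ (Fin d))).toSphere

instance sphereUniform.instIsProbabilityMeasure (d : ℕ) [NeZero d] :
    IsProbabilityMeasure (sphereUniform d) := by
  refine ⟨?_⟩
  have h0 : (volume : Measure (EuclideanSpace ℝ (Fin d))).toSphere Set.univ ≠ 0 := by
    rw [Ne, Measure.measure_univ_eq_zero]
    exact Measure.toSphere_ne_zero _
  simp only [sphereUniform, Measure.smul_apply, smul_eq_mul]
  exact ENNReal.inv_mul_cancel h0 (measure_ne_top _ _)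

/-- The SimHash function determined by a unit vector `z`: it maps `x` to the sign of `⟨x, z⟩`.
A random SimHash function is obtained by drawing `z` from `sphereUniform d`. -/
def simHash {d : ℕ} (z : Metric.sphere (0 : EuclideanSpace ℝ (Fin d)) 1)
    (x : EuclideanSpace ℝ (Fin d)) : SignType :=
  SignType.sign (inner ℝ x (z : EuclideanSpace ℝ (Fin d)))

/-- The distribution of a family `(n_u)`, `u ∈ 𝒰`, of independent uniform random numbers
in `[0, 1]`. -/
def uniformLabels (𝒰 : Type*) : Measure (𝒰 → unitInterval) :=
  Measure.infinitePi fun _ : 𝒰 => (volume : Measure unitInterval)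

instance uniformLabels.instIsProbabilityMeasure (𝒰 : Type*) :
    IsProbabilityMeasure (uniformLabels 𝒰) := by
  unfold uniformLabels
  infer_instance

/-- The MinHash function determined by the numbers `(n_u)`, `u ∈ 𝒰`: it maps a (nonempty) finite
set `x` to the minimum of `n_u` over `u ∈ x`. A random MinHash function is obtained by
drawing the numbers from `uniformLabels 𝒰`. -/
def minHash {𝒰 : Type*} (n : 𝒰 → unitInterval) (x : Finset 𝒰) : unitInterval :=
  x.inf n

/-- `π` assigns to every `p ∈ P` a nearest neighbor ordering of `P`, that is an enumeration of `P`
along which the similarity to `p` does not increase. Positions are counted from `0`, so the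
`i`-th nearest neighbor of `p` is `π p` at position `i - 1`. -/
def IsNNOrdering {α : Type*} (P : Finset α) (μ : α → α → ℝ) (π : P → Fin P.card ≃ P) : Prop :=
  ∀ p : P, Antitone fun i : Fin P.card => μ p (π p i)

/-- The probability that `p` and `q` agree on `ℓ` independently drawn hash functions
`h_1, …, h_ℓ`, where a hash function is drawn as `h ω` with `ω` distributed according to `ν`. -/
def prefixCollisionProb {Ω α U : Type*} [MeasurableSpace Ω] (ν : Measure Ω) (h : Ω → α → U)
    (ℓ : ℕ) (p q : α) : ℝ :=
  (Measure.pi fun _ : Fin ℓ => ν).real {ω | (fun j => h (ω j) p) = fun j => h (ω j) q}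

/-- `A` is a `(k, ρ, L)`-ANN family for the point set `P` with nearest neighbor ordering `π`,
with respect to the hash family `h ω`, `ω ∼ ν`. -/
def IsANNFamily {Ω α U : Type*} [MeasurableSpace Ω] (ν : Measure Ω) [IsProbabilityMeasure ν]
    (h : Ω → α → U) (P : Finset α) (π : P → Fin P.card ≃ P) (k : ℕ) (ρ L : ℝ)
    (A : P → Set P) : Prop :=
  ∀ p : P,
    (∃ m : ℕ, k ≤ m ∧ m ≤ P.card ∧ A p = π p '' {i | (i : ℕ) < m}) ∧
    ∃ ℓ : ℕ, (ℓ : ℝ) ≤ L ∧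
      (∀ i : Fin P.card, (i : ℕ) < k →
        (P.card : ℝ) ^ (-ρ) ≤ prefixCollisionProb ν h ℓ (p : α) (π p i)) ∧
      ∀ x : P, x ∉ A p → prefixCollisionProb ν h ℓ (p : α) x ≤ (P.card : ℝ) ^ (-4 : ℝ)

/-- The sets `A_p = {x ∈ P | μ(p, x) ≥ min (1 - s_k(p) / ε) (1 - 1 / M)}`, where
`s_k(p) = 1 - τ_k(p)` and `τ_k(p)` is the similarity of `p` to its `k`-th nearest neighbor. The
argument `κ` is the position (counted from `0`) of the `k`-th nearest neighbor, `κ = k - 1`. -/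
def approxNeighbors {α : Type*} (P : Finset α) (μ : α → α → ℝ) (π : P → Fin P.card ≃ P)
    (κ : Fin P.card) (ε M : ℝ) (p : P) : Set P :=
  {x | min (1 - ε⁻¹ * (1 - μ p (π p κ))) (1 - 1 / M) ≤ μ p x}

end

/-! For both hash families the collision probability equals the similarity, and by independence a
prefix of length `ℓ` collides with probability `μ ^ ℓ`. With `t = max (s / ε) (1 / M)`, the set
`A_p` is `{μ ≥ 1 - t}`; take `ℓ = ⌊4 log n / t⌋`, which is at most `4 M log n`. Outside `A_p` the
power is at most `(1 - t) ^ ℓ ≤ n ^ (-4)`; for the `k` nearest points it is at least `(1 - s) ^ ℓ`,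
and `s ≤ ε t` makes this `n ^ (-O(ε))`. Both estimates are in `isANNFamily_approxNeighbors`.

MinHash (`uniformLabels_minHash_eq`): the element of `x ∪ y` with least label is uniformly
distributed, and the two hashes agree almost surely iff it lies in `x ∩ y`.

SimHash (`separationProb_eq`): the probability of separating two points of a circle is invariant
under isometries and additive in the angle, hence linear, with value `1` at angle `π`. -/

/-! ### Prefix lengths, and the reduction to collision probabilities -/

theorem prefixCollisionProb_eq_pow {Ω α U : Type*} [MeasurableSpace Ω] (ν : Measure Ω)
    [IsProbabilityMeasure ν] (h : Ω → α → U) (ℓ : ℕ) (p q : α) :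
    prefixCollisionProb ν h ℓ p q = ν.real {ω | h ω p = h ω q} ^ ℓ := by
  have hset : {ω : Fin ℓ → Ω | (fun j => h (ω j) p) = fun j => h (ω j) q} =
      Set.pi Set.univ fun _ => {ω | h ω p = h ω q} := by
    ext ω
    simp [funext_iff]
  rw [prefixCollisionProb, hset, measureReal_def, Measure.pi_pi, measureReal_def]
  simp

/-- Sharper than `t ≤ -log (1 - t)`: the second-order gain pays for rounding the prefix length down.
-/
theorem two_mul_div_le_neg_log {t : ℝ} (h0 : 0 ≤ t) (h1 : t < 1) :
    2 * t / (2 - t) ≤ -Real.log (1 - t) := by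
  have hpos : 0 < 1 - t := by linarith
  have h := Real.le_log_one_add_of_nonneg (x := t / (1 - t)) (by positivity)
  have e1 : 1 + t / (1 - t) = (1 - t)⁻¹ := by field_simp; ring
  have e2 : 2 * (t / (1 - t)) / (t / (1 - t) + 2) = 2 * t / (2 - t) := by
    have : 2 - t ≠ 0 := by linarith
    have h3 : t / (1 - t) + 2 = (2 - t) / (1 - t) := by field_simp; ring
    rw [h3]
    field_simp
  rwa [e1, Real.log_inv, e2] at h

/-- Prefix length for threshold `t`: `⌊4 log n / t⌋` hash functions separate all points of
dissimilarity greater than `t`. -/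
theorem pow_floor_le_rpow {n : ℕ} (hn : 2 ≤ n) {t c : ℝ} (ht0 : 0 < t) (ht1 : t < 1)
    (hc0 : 0 ≤ c) (hc : c ≤ 1 - t) :
    c ^ ⌊4 * Real.log n / t⌋₊ ≤ (n : ℝ) ^ (-4 : ℝ) := by
  have hn0 : (0 : ℝ) < n := by positivity
  have hlog : 1 / 2 < Real.log n := by
    have h2 : Real.log 2 ≤ Real.log n := Real.log_le_log (by norm_num) (by exact_mod_cast hn)
    have := Real.log_two_gt_d9
    linarith
  set a := 4 * Real.log n / t with ha
  have hat : a * t = 4 * Real.log n := by rw [ha]; field_simp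
  have hfl : a - 1 ≤ (⌊a⌋₊ : ℝ) := by linarith [Nat.lt_floor_add_one a]
  have hpos : 0 < 1 - t := by linarith
  refine (pow_le_pow_left₀ hc0 hc _).trans ?_
  rw [← Real.rpow_natCast, Real.rpow_def_of_pos hpos, Real.rpow_def_of_pos hn0, Real.exp_le_exp]
  have h1 := two_mul_div_le_neg_log ht0.le ht1
  -- Equivalent to `2 ≤ a * t = 4 * log n`, hence the need for `1 / 2 < log n`.
  have h2 : a ≤ (a - 1) * (2 / (2 - t)) := by
    have : 0 < 2 - t := by linarith
    rw [mul_div_assoc', le_div_iff₀ this]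
    nlinarith
  have h3 : (a - 1) * (2 / (2 - t)) * t ≤ ⌊a⌋₊ * -Real.log (1 - t) := by
    calc (a - 1) * (2 / (2 - t)) * t = (a - 1) * (2 * t / (2 - t)) := by ring
      _ ≤ ⌊a⌋₊ * (2 * t / (2 - t)) := by
          have : 0 < 2 - t := by linarith
          gcongr
      _ ≤ _ := by gcongr
  nlinarith

/-- Since `s ≤ ε₀`, each factor costs `-log (1 - s) ≤ s / (1 - s) ≤ s / (1 - ε₀)`. At most `4 log n
/ t` factors with `s / t ≤ ε` give the exponent. -/
theorem rpow_le_pow_floor {n : ℕ} (hn : 1 ≤ n) {ε₀ ε t s c : ℝ} (hε₀ : ε₀ < 1) (hε : 0 ≤ ε)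
    (hle : ε ≤ ε₀) (ht0 : 0 < t) (ht1 : t < 1) (hs0 : 0 ≤ s) (hs : s ≤ ε * t) (hc : 1 - s ≤ c) :
    (n : ℝ) ^ (-(4 / (1 - ε₀) * ε)) ≤ c ^ ⌊4 * Real.log n / t⌋₊ := by
  have hn0 : (0 : ℝ) < n := by positivity
  have hlog : 0 ≤ Real.log n := Real.log_natCast_nonneg n
  have hs1 : s ≤ ε₀ := by nlinarith
  have hpos : 0 < 1 - s := by linarith
  have hpos' : 0 < 1 - ε₀ := by linarith
  refine le_trans ?_ (pow_le_pow_left₀ hpos.le hc _)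
  rw [← Real.rpow_natCast, Real.rpow_def_of_pos hpos, Real.rpow_def_of_pos hn0, Real.exp_le_exp]
  have h1 : -Real.log (1 - s) ≤ s / (1 - ε₀) := by
    rw [← Real.log_inv]
    refine (Real.log_le_sub_one_of_pos (by positivity)).trans ?_
    have : (1 - s)⁻¹ - 1 = s / (1 - s) := by field_simp; ring
    rw [this]
    gcongr
  have h2 : (⌊4 * Real.log n / t⌋₊ : ℝ) ≤ 4 * Real.log n / t := Nat.floor_le (by positivity)
  have h3 : -Real.log (1 - s) * ⌊4 * Real.log n / t⌋₊ ≤ ε * t / (1 - ε₀) * (4 * Real.log n / t) :=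
    mul_le_mul (h1.trans (by gcongr)) h2 (by positivity) (by positivity)
  have h4 : ε * t / (1 - ε₀) * (4 * Real.log n / t) = Real.log n * (4 / (1 - ε₀) * ε) := by
    field_simp
  linarith

theorem exists_prefix_image {α : Type*} (P : Finset α) (μ : α → α → ℝ) (π : P → Fin P.card ≃ P)
    (hπ : IsNNOrdering P μ π) (p : P) (b : ℝ) (k : ℕ) (hk : k ≤ P.card)
    (hb : ∀ i : Fin P.card, (i : ℕ) < k → b ≤ μ p (π p i)) :
    ∃ m : ℕ, k ≤ m ∧ m ≤ P.card ∧ {x : P | b ≤ μ p x} = π p '' {i | (i : ℕ) < m} := by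
  classical
  by_cases hall : ∀ i : Fin P.card, b ≤ μ p (π p i)
  · refine ⟨P.card, hk, le_rfl, ?_⟩
    ext x
    simpa using by simpa using hall ((π p).symm x)
  · push Not at hall
    have hex : ∃ m : ℕ, ∃ hm : m < P.card, μ p (π p ⟨m, hm⟩) < b := by
      obtain ⟨i, hi⟩ := hall
      exact ⟨i, i.2, hi⟩
    obtain ⟨hm, hlt⟩ := Nat.find_spec hex
    -- The prefix ends just before the first position whose similarity falls below `b`.
    refine ⟨Nat.find hex, ?_, hm.le, ?_⟩
    · by_contra! hcon
      exact absurd hlt (not_lt.2 (hb ⟨_, hm⟩ hcon))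
    · ext x
      obtain ⟨i, rfl⟩ := (π p).surjective x
      simp only [Set.mem_ofPred_eq, (π p).injective.mem_set_image]
      constructor
      · intro hi
        by_contra! hcon
        have := hπ p (show (⟨_, hm⟩ : Fin P.card) ≤ i from hcon)
        exact absurd (hi.trans this) (not_le.2 hlt)
      · intro hi
        by_contra! hcon
        exact Nat.find_min hex hi ⟨i.2, hcon⟩

/-- If the collision probability of two points is their similarity, then the approximate
neighbors form an ANN family. -/
theorem isANNFamily_approxNeighbors {Ω α U : Type*} [MeasurableSpace Ω] (ν : Measure Ω)
    [IsProbabilityMeasure ν] (h : Ω → α → U) (P : Finset α) (μ : α → α → ℝ)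
    (hν : ∀ p ∈ P, ∀ q ∈ P, ν.real {ω | h ω p = h ω q} = μ p q)
    (π : P → Fin P.card ≃ P) (hπ : IsNNOrdering P μ π) {k : ℕ} (κ : Fin P.card)
    (hκ : (κ : ℕ) + 1 = k) {ε₀ ε M : ℝ} (hε₀ : ε₀ < 1) (hε : 0 < ε) (hle : ε ≤ ε₀)
    (hM : 1 ≤ M) :
    IsANNFamily ν h P π k (4 / (1 - ε₀) * ε) (4 * M * Real.log P.card)
      (approxNeighbors P μ π κ ε M) := by
  have hμ0 : ∀ p q : P, 0 ≤ μ p q := fun p q => by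
    rw [← hν p p.2 q q.2]
    exact measureReal_nonneg
  have hμ1 : ∀ p q : P, μ p q ≤ 1 := fun p q => by
    rw [← hν p p.2 q q.2]
    exact measureReal_le_one
  intro p
  have hM0 : 0 < M := by linarith
  set s := 1 - μ p (π p κ) with hs
  have hs0 : 0 ≤ s := by linarith [hμ1 p (π p κ)]
  have hnear : ∀ i : Fin P.card, (i : ℕ) < k → 1 - s ≤ μ p (π p i) := by
    intro i hi
    have := hπ p (show i ≤ κ from Fin.le_def.2 (by omega))
    simp only at this
    linarith
  have hsε : s ≤ ε⁻¹ * s := le_mul_of_one_le_left hs0 (one_le_inv_iff₀.2 ⟨hε, by linarith⟩)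
  have hcard : 1 ≤ P.card := Fin.pos κ
  refine ⟨exists_prefix_image P μ π hπ p _ k (by omega) fun i hi => ?_, ?_⟩
  · exact (min_le_left _ _).trans (by linarith [hnear i hi])
  -- `1 - t` is the similarity threshold defining `A_p`.
  set t := max (ε⁻¹ * s) (1 / M) with ht
  have hA : ∀ x : P, x ∉ approxNeighbors P μ π κ ε M p → μ p x < 1 - t := by
    intro x hx
    simp only [approxNeighbors, Set.mem_ofPred_eq, not_le, lt_min_iff] at hx
    rw [ht, lt_sub_comm, max_lt_iff]
    exact ⟨by linarith [hx.1], by linarith [hx.2]⟩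
  have ht0 : 0 < t := lt_max_of_lt_right (by positivity)
  have hlog : 0 ≤ Real.log P.card := Real.log_natCast_nonneg _
  simp only [prefixCollisionProb_eq_pow, hν p p.2 _ (Subtype.prop _)]
  -- Otherwise the empty prefix works: if `t ≥ 1` no point lies outside `A_p`, and if `n = 1` the
  -- bound `n ^ (-4)` is `1`.
  by_cases hcase : 2 ≤ P.card ∧ t < 1
  · obtain ⟨hn, ht1⟩ := hcase
    refine ⟨⌊4 * Real.log P.card / t⌋₊, ?_, fun i hi => ?_, fun x hx => ?_⟩
    · refine (Nat.floor_le (by positivity)).trans ?_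
      have : 1 ≤ M * t := by
        have := mul_le_mul_of_nonneg_left (le_max_right (ε⁻¹ * s) (1 / M)) hM0.le
        rwa [mul_one_div_cancel hM0.ne'] at this
      rw [div_le_iff₀ ht0]
      nlinarith
    · refine rpow_le_pow_floor hcard hε₀ hε.le hle ht0 ht1 hs0 ?_ (hnear i hi)
      have := mul_le_mul_of_nonneg_left (le_max_left (ε⁻¹ * s) (1 / M)) hε.le
      rwa [mul_inv_cancel_left₀ hε.ne'] at this
    · exact pow_floor_le_rpow hn ht0 ht1 (hμ0 p x) (hA x hx).le
  · refine ⟨0, by simpa using by positivity, fun i _ => ?_, fun x hx => ?_⟩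
    · rw [pow_zero]
      refine Real.rpow_le_one_of_one_le_of_nonpos (by exact_mod_cast hcard) ?_
      have : 0 < 1 - ε₀ := by linarith
      simp only [Left.neg_nonpos_iff]
      positivity
    · have h1 : P.card = 1 := by
        by_contra hne
        have := hA x hx
        have := hμ0 p x
        exact hcase ⟨by omega, by linarith⟩
      simp [h1]

/-! ### MinHash and Jaccard similarity -/

theorem uniformLabels_eq_null {𝒰 : Type*} {u v : 𝒰} (huv : u ≠ v) :
    uniformLabels 𝒰 {n | n u = n v} = 0 := by
  have hd : MeasurableSet {q : unitInterval × unitInterval | q.1 = q.2} :=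
    measurableSet_eq_fun measurable_fst measurable_snd
  have h := Measure.infinitePi_map_eval_prod
    (P := fun _ : 𝒰 => (volume : Measure unitInterval)) huv
  have h1 : uniformLabels 𝒰 {n | n u = n v} =
      (volume : Measure unitInterval).prod volume {q | q.1 = q.2} := by
    rw [← h, Measure.map_apply (by fun_prop) hd]
    rfl
  rw [h1, Measure.measure_prod_null hd]
  refine Filter.Eventually.of_forall fun a => ?_
  have : Prod.mk a ⁻¹' {q : unitInterval × unitInterval | q.1 = q.2} = {a} := by
    ext b
    simp [eq_comm]
  simp [this]

/-- The event that `u` has the least label among the elements of `S`. -/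
def argminEvent {𝒰 : Type*} (S : Finset 𝒰) (u : 𝒰) : Set (𝒰 → unitInterval) :=
  {n | ∀ v ∈ S, n u ≤ n v}

theorem measurableSet_argminEvent {𝒰 : Type*} (S : Finset 𝒰) (u : 𝒰) :
    MeasurableSet (argminEvent S u) := by
  have : argminEvent S u = ⋂ v ∈ S, {n | n u ≤ n v} := by
    ext n
    simp [argminEvent]
  rw [this]
  exact Finset.measurableSet_biInter _ fun v _ => measurableSet_le (by fun_prop) (by fun_prop)

theorem aedisjoint_argminEvent {𝒰 : Type*} {S : Finset 𝒰} {u v : 𝒰} (hu : u ∈ S) (hv : v ∈ S)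
    (huv : u ≠ v) : AEDisjoint (uniformLabels 𝒰) (argminEvent S u) (argminEvent S v) :=
  measure_mono_null (fun _ hn => le_antisymm (hn.1 v hv) (hn.2 u hu)) (uniformLabels_eq_null huv)

/-- The labels are exchangeable: swapping those of `u` and `v` preserves the measure and maps `S` to
itself. -/
theorem uniformLabels_argminEvent_eq {𝒰 : Type*} {S : Finset 𝒰} {u v : 𝒰} (hu : u ∈ S)
    (hv : v ∈ S) :
    (uniformLabels 𝒰).real (argminEvent S u) = (uniformLabels 𝒰).real (argminEvent S v) := by
  classical
  have h := Measure.map_infinitePi_infinitePi_of_inj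
    (P := fun _ : 𝒰 => (volume : Measure unitInterval)) (Equiv.swap u v).injective
  have hpre : (fun (n : 𝒰 → unitInterval) i => n (Equiv.swap u v i)) ⁻¹' argminEvent S u =
      argminEvent S v := by
    ext n
    simp only [argminEvent, Set.mem_preimage, Set.mem_ofPred_eq, Equiv.swap_apply_left]
    have hS : ∀ w, w ∈ S → Equiv.swap u v w ∈ S := fun w hw => by
      rw [Equiv.swap_apply_def]
      split_ifs <;> assumption
    refine ⟨fun hn w hw => ?_, fun hn w hw => hn _ (hS w hw)⟩
    simpa using hn _ (hS w hw)
  rw [← hpre, measureReal_def, measureReal_def]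
  conv_lhs => rw [uniformLabels, ← h]
  rw [Measure.map_apply (by fun_prop) (measurableSet_argminEvent S u)]
  rfl

/-- Used with `T = S` to find the common probability, then with `T = x ∩ y`, `S = x ∪ y`. -/
theorem uniformLabels_biUnion_argminEvent {𝒰 : Type*} {S T : Finset 𝒰} (hT : T ⊆ S) {u : 𝒰}
    (hu : u ∈ S) :
    (uniformLabels 𝒰).real (⋃ v ∈ T, argminEvent S v) =
      T.card * (uniformLabels 𝒰).real (argminEvent S u) := by
  rw [measureReal_biUnion_finset₀
    (fun a ha b hb hab => aedisjoint_argminEvent (hT ha) (hT hb) hab)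
    fun v _ => (measurableSet_argminEvent S v).nullMeasurableSet,
    Finset.sum_congr rfl fun v hv => uniformLabels_argminEvent_eq (hT hv) hu]
  simp

theorem uniformLabels_argminEvent {𝒰 : Type*} {S : Finset 𝒰} {u : 𝒰} (hu : u ∈ S) :
    (uniformLabels 𝒰).real (argminEvent S u) = (S.card : ℝ)⁻¹ := by
  have h := uniformLabels_biUnion_argminEvent subset_rfl hu
  have huniv : ⋃ v ∈ S, argminEvent S v = Set.univ := by
    refine Set.eq_univ_of_forall fun n => ?_
    obtain ⟨v, hv, hmin⟩ := S.exists_min_image n ⟨u, hu⟩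
    exact Set.mem_biUnion hv hmin
  rw [huniv, probReal_univ] at h
  exact eq_inv_of_mul_eq_one_right h.symm

/-- Two nonempty finite sets have the same MinHash value with probability equal to their
Jaccard similarity. -/
theorem uniformLabels_minHash_eq {𝒰 : Type*} [DecidableEq 𝒰] {x y : Finset 𝒰}
    (hx : x.Nonempty) (hy : y.Nonempty) :
    (uniformLabels 𝒰).real {n | minHash n x = minHash n y} = jaccardSim x y := by
  obtain ⟨u, hu⟩ : (x ∪ y).Nonempty := hx.mono Finset.subset_union_left
  have hae : {n | minHash n x = minHash n y} =ᵐ[uniformLabels 𝒰]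
      ⋃ v ∈ x ∩ y, argminEvent (x ∪ y) v := by
    have hties : ∀ᵐ n ∂uniformLabels 𝒰, ∀ a ∈ x ∪ y, ∀ b ∈ x ∪ y, a ≠ b → n a ≠ n b := by
      simp only [← Finset.mem_coe]
      refine (ae_ball_iff (x ∪ y).countable_toSet).2 fun a _ =>
        (ae_ball_iff (x ∪ y).countable_toSet).2 fun b _ => ?_
      by_cases hab : a = b
      · simp [hab]
      · filter_upwards [measure_eq_zero_iff_ae_notMem.1 (uniformLabels_eq_null hab)] with n hn _
        exact hn
    rw [Filter.eventuallyEq_set]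
    filter_upwards [hties] with n hn
    simp only [Set.mem_iUnion, minHash, exists_prop]
    constructor
    · intro he
      obtain ⟨a, ha, hae⟩ := Finset.exists_mem_eq_inf x hx n
      obtain ⟨b, hb, hbe⟩ := Finset.exists_mem_eq_inf y hy n
      have hab : a = b := by
        by_contra hne
        exact hn a (Finset.mem_union_left _ ha) b (Finset.mem_union_right _ hb) hne
          (by rw [← hae, ← hbe, he])
      subst hab
      refine ⟨a, Finset.mem_inter.2 ⟨ha, hb⟩, fun v hv => ?_⟩
      rcases Finset.mem_union.1 hv with hv | hv
      · rw [← hae]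
        exact Finset.inf_le hv
      · rw [← hbe]
        exact Finset.inf_le hv
    · rintro ⟨a, ha, hmin⟩
      obtain ⟨hax, hay⟩ := Finset.mem_inter.1 ha
      have e1 : x.inf n = n a := le_antisymm (Finset.inf_le hax)
        (Finset.le_inf fun v hv => hmin v (Finset.mem_union_left _ hv))
      have e2 : y.inf n = n a := le_antisymm (Finset.inf_le hay)
        (Finset.le_inf fun v hv => hmin v (Finset.mem_union_right _ hv))
      rw [e1, e2]
  rw [measureReal_congr hae, uniformLabels_biUnion_argminEvent
    (Finset.inter_subset_union) hu, uniformLabels_argminEvent hu, jaccardSim, div_eq_mul_inv]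

/-! ### SimHash: the sphere measure and separating hyperplanes -/

open scoped Pointwise in
theorem sphereUniform_cone {d : ℕ} [NeZero d] {C : Set (EuclideanSpace ℝ (Fin d))}
    (hC : MeasurableSet C) (hcone : ∀ r : ℝ, 0 < r → ∀ z, r • z ∈ C ↔ z ∈ C) :
    sphereUniform d {z | (z : EuclideanSpace ℝ (Fin d)) ∈ C} =
      (volume (Metric.ball (0 : EuclideanSpace ℝ (Fin d)) 1))⁻¹ *
        volume (Metric.ball (0 : EuclideanSpace ℝ (Fin d)) 1 ∩ C) := by
  have hset : Set.Ioo (0 : ℝ) 1 • ((↑) '' {z : Metric.sphere (0 : EuclideanSpace ℝ (Fin d)) 1 |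
      (z : EuclideanSpace ℝ (Fin d)) ∈ C}) = (Metric.ball 0 1 ∩ C) \ {0} := by
    ext w
    simp only [Set.mem_smul, Set.mem_image, Set.mem_sdiff, Set.mem_inter_iff, Set.mem_singleton_iff,
      Metric.mem_ball, dist_zero_right]
    constructor
    · rintro ⟨r, ⟨hr0, hr1⟩, _, ⟨z, hz, rfl⟩, rfl⟩
      have hz1 : ‖(z : EuclideanSpace ℝ (Fin d))‖ = 1 := norm_eq_of_mem_sphere z
      refine ⟨⟨?_, (hcone r hr0 _).2 hz⟩, smul_ne_zero hr0.ne' (norm_ne_zero_iff.1 (by simp))⟩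
      rw [norm_smul, hz1, Real.norm_of_nonneg hr0.le]
      linarith
    · rintro ⟨⟨h1, hw⟩, h0⟩
      have hpos : 0 < ‖w‖ := norm_pos_iff.2 h0
      refine ⟨‖w‖, ⟨hpos, h1⟩, ‖w‖⁻¹ • w, ⟨⟨‖w‖⁻¹ • w, ?_⟩, ?_, rfl⟩, ?_⟩
      · simp [norm_smul, hpos.ne']
      · exact (hcone _ (by positivity) _).2 hw
      · simp [smul_smul, hpos.ne']
  have hd : (d : ENNReal) ≠ 0 := by exact_mod_cast NeZero.ne d
  simp only [sphereUniform, Measure.smul_apply, smul_eq_mul]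
  have hmeas : MeasurableSet {z : Metric.sphere (0 : EuclideanSpace ℝ (Fin d)) 1 |
      (z : EuclideanSpace ℝ (Fin d)) ∈ C} := hC.preimage measurable_subtype_coe
  rw [Measure.toSphere_apply' _ hmeas, hset,
    measure_sdiff_null (measure_singleton _), Measure.toSphere_apply_univ,
    finrank_euclideanSpace_fin, ENNReal.mul_inv (Or.inl hd) (Or.inl (ENNReal.natCast_ne_top d)),
    mul_mul_mul_comm, ENNReal.inv_mul_cancel hd (ENNReal.natCast_ne_top d), one_mul]

theorem sphereUniform_inner_eq_zero {d : ℕ} [NeZero d] {x : EuclideanSpace ℝ (Fin d)}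
    (hx : x ≠ 0) :
    sphereUniform d {z | inner ℝ x (z : EuclideanSpace ℝ (Fin d)) = 0} = 0 := by
  have h := sphereUniform_cone (d := d) (C := {w | inner ℝ x w = 0})
    (measurableSet_eq_fun (by fun_prop) (by fun_prop)) fun r hr z => by
      simp [inner_smul_right, hr.ne']
  refine h.trans ?_
  have hnull : volume {w : EuclideanSpace ℝ (Fin d) | inner ℝ x w = 0} = 0 := by
    have hne : LinearMap.ker (innerₛₗ ℝ x) ≠ ⊤ := fun htop => by
      have : x ∈ LinearMap.ker (innerₛₗ ℝ x) := htop ▸ Submodule.mem_top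
      exact hx (by simpa using this)
    exact Measure.addHaar_submodule volume _ hne
  rw [measure_mono_null Set.inter_subset_right hnull, mul_zero]

theorem ae_inner_ne_zero {d : ℕ} [NeZero d] {x : EuclideanSpace ℝ (Fin d)} (hx : x ≠ 0) :
    ∀ᵐ z : Metric.sphere (0 : EuclideanSpace ℝ (Fin d)) 1 ∂sphereUniform d,
      inner ℝ x (z : EuclideanSpace ℝ (Fin d)) ≠ 0 :=
  measure_eq_zero_iff_ae_notMem.1 (sphereUniform_inner_eq_zero hx)

/-- The probability that a random hyperplane through the origin separates `x` and `y`. -/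
noncomputable def separationProb {d : ℕ} (x y : EuclideanSpace ℝ (Fin d)) : ℝ :=
  (sphereUniform d).real
    {z | inner ℝ x (z : EuclideanSpace ℝ (Fin d)) * inner ℝ y (z : EuclideanSpace ℝ (Fin d)) < 0}

theorem separationProb_comm {d : ℕ} (x y : EuclideanSpace ℝ (Fin d)) :
    separationProb x y = separationProb y x := by
  simp only [separationProb, mul_comm]

theorem separationProb_smul {d : ℕ} (x y : EuclideanSpace ℝ (Fin d)) {r s : ℝ} (hr : 0 < r)
    (hs : 0 < s) : separationProb (r • x) (s • y) = separationProb x y := by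
  simp only [separationProb, real_inner_smul_left]
  congr 1
  ext z
  simp only [Set.mem_ofPred_eq]
  rw [mul_mul_mul_comm, ← smul_eq_mul (r * s), smul_neg_iff_of_pos_left (mul_pos hr hs)]

theorem separationProb_self {d : ℕ} (x : EuclideanSpace ℝ (Fin d)) : separationProb x x = 0 := by
  simp [separationProb, not_lt.2 (mul_self_nonneg _)]

theorem separationProb_neg {d : ℕ} [NeZero d] {x : EuclideanSpace ℝ (Fin d)} (hx : x ≠ 0) :
    separationProb x (-x) = 1 := by
  refine Eq.trans ?_ (probReal_univ (μ := sphereUniform d))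
  refine measureReal_congr (Filter.eventuallyEq_set.2 ?_)
  filter_upwards [ae_inner_ne_zero hx] with z hz
  simpa using mul_self_pos.2 hz

/-- The separating directions form a cone, so `sphereUniform_cone` turns the claim into invariance
of Lebesgue measure on the unit ball. -/
theorem separationProb_map {d : ℕ} [NeZero d]
    (R : EuclideanSpace ℝ (Fin d) ≃ₗᵢ[ℝ] EuclideanSpace ℝ (Fin d))
    (x y : EuclideanSpace ℝ (Fin d)) : separationProb (R x) (R y) = separationProb x y := by
  have hmeas : ∀ u v : EuclideanSpace ℝ (Fin d),
      MeasurableSet {w : EuclideanSpace ℝ (Fin d) | inner ℝ u w * inner ℝ v w < 0} := fun u v =>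
    measurableSet_lt (by fun_prop) (by fun_prop)
  have hcone : ∀ (u v : EuclideanSpace ℝ (Fin d)) (r : ℝ), 0 < r → ∀ z,
      r • z ∈ {w : EuclideanSpace ℝ (Fin d) | inner ℝ u w * inner ℝ v w < 0} ↔
        z ∈ {w : EuclideanSpace ℝ (Fin d) | inner ℝ u w * inner ℝ v w < 0} := fun u v r hr z => by
    simp only [Set.mem_ofPred_eq, real_inner_smul_right]
    rw [mul_mul_mul_comm, ← smul_eq_mul (r * r), smul_neg_iff_of_pos_left (mul_pos hr hr)]
  have hvol : volume (Metric.ball (0 : EuclideanSpace ℝ (Fin d)) 1 ∩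
      {w | inner ℝ (R x) w * inner ℝ (R y) w < 0}) =
      volume (Metric.ball (0 : EuclideanSpace ℝ (Fin d)) 1 ∩
        {w | inner ℝ x w * inner ℝ y w < 0}) := by
    rw [← R.measurePreserving.measure_preimage
      (Metric.isOpen_ball.measurableSet.inter (hmeas _ _)).nullMeasurableSet]
    congr 1
    ext w
    simp
  have h1 := sphereUniform_cone (hmeas (R x) (R y)) (hcone _ _)
  have h2 := sphereUniform_cone (hmeas x y) (hcone _ _)
  rw [hvol, ← h2] at h1
  exact congrArg ENNReal.toReal h1

/-- The point at angle `φ` on the unit circle of the plane spanned by `e` and `f`. -/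
noncomputable def circlePoint {d : ℕ} (e f : EuclideanSpace ℝ (Fin d)) (φ : ℝ) : EuclideanSpace ℝ (Fin d) :=
  Real.cos φ • e + Real.sin φ • f

/-! ### Separation probability along a circle -/

section circlePoint

variable {d : ℕ} {e f : EuclideanSpace ℝ (Fin d)}

theorem circlePoint_zero : circlePoint e f 0 = e := by simp [circlePoint]

theorem circlePoint_pi : circlePoint e f Real.pi = -e := by simp [circlePoint]

theorem inner_circlePoint (he : ‖e‖ = 1) (hf : ‖f‖ = 1) (hef : inner ℝ e f = 0) (a b : ℝ) :
    inner ℝ (circlePoint e f a) (circlePoint e f b) = Real.cos (b - a) := by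
  have hfe : inner ℝ f e = 0 := by rw [real_inner_comm, hef]
  simp only [circlePoint, inner_add_left, inner_add_right, real_inner_smul_left,
    real_inner_smul_right, real_inner_self_eq_norm_sq, he, hf, hef, hfe, Real.cos_sub]
  ring

theorem norm_circlePoint (he : ‖e‖ = 1) (hf : ‖f‖ = 1) (hef : inner ℝ e f = 0) (a : ℝ) :
    ‖circlePoint e f a‖ = 1 := by
  have h := inner_circlePoint he hf hef a a
  rw [real_inner_self_eq_norm_sq, sub_self, Real.cos_zero] at h
  exact (pow_eq_one_iff_of_nonneg (norm_nonneg _) two_ne_zero).1 h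

theorem reflection_circlePoint (he : ‖e‖ = 1) (hf : ‖f‖ = 1) (hef : inner ℝ e f = 0) (a b : ℝ) :
    (ℝ ∙ circlePoint e f a).reflection (circlePoint e f b) = circlePoint e f (2 * a - b) := by
  have h1 : Real.cos (2 * a - b) = 2 * Real.cos (b - a) * Real.cos a - Real.cos b := by
    rw [Real.cos_sub, Real.cos_sub, Real.cos_two_mul, Real.sin_two_mul]
    ring
  have h2 : Real.sin (2 * a - b) = 2 * Real.cos (b - a) * Real.sin a - Real.sin b := by
    rw [Real.sin_sub, Real.cos_sub, Real.cos_two_mul, Real.sin_two_mul]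
    linear_combination (-2 * Real.sin b) * Real.sin_sq_add_cos_sq a
  rw [Submodule.reflection_singleton_apply, inner_circlePoint he hf hef,
    norm_circlePoint he hf hef]
  simp only [circlePoint, h1, h2, RCLike.ofReal_real_eq_id, id, one_pow, div_one]
  module

/-- Reflecting in the line at angle `b / 2` sends `b` to `0` and `a` to `b - a`. -/
theorem separationProb_circlePoint_sub [NeZero d] (he : ‖e‖ = 1) (hf : ‖f‖ = 1)
    (hef : inner ℝ e f = 0) (a b : ℝ) :
    separationProb (circlePoint e f a) (circlePoint e f b) =
      separationProb e (circlePoint e f (b - a)) := by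
  have h := separationProb_map ((ℝ ∙ circlePoint e f (b / 2)).reflection)
    (circlePoint e f a) (circlePoint e f b)
  rw [reflection_circlePoint he hf hef, reflection_circlePoint he hf hef] at h
  rw [← h, separationProb_comm]
  congr 1
  · rw [mul_div_cancel₀ b two_ne_zero, sub_self, circlePoint_zero]
  · rw [mul_div_cancel₀ b two_ne_zero]

/-- Almost surely, a hyperplane separating angles `0` and `b` separates exactly one of the pairs
`(0, a)`, `(a, b)`. It never separates both, as the point at `a` lies in the arc between the others.
-/
theorem separationProb_circlePoint_add [NeZero d] (he : ‖e‖ = 1) (hf : ‖f‖ = 1)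
    (hef : inner ℝ e f = 0) {a b : ℝ} (ha : 0 ≤ a) (hab : a ≤ b) (hb : b ≤ Real.pi) :
    separationProb e (circlePoint e f b) =
      separationProb e (circlePoint e f a) + separationProb e (circlePoint e f (b - a)) := by
  rw [← separationProb_circlePoint_sub he hf hef a b]
  unfold separationProb
  have hne : ∀ c, circlePoint e f c ≠ 0 := fun c => by
    rw [← norm_ne_zero_iff, norm_circlePoint he hf hef]
    exact one_ne_zero
  have hmeas : MeasurableSet {z : Metric.sphere (0 : EuclideanSpace ℝ (Fin d)) 1 |
      inner ℝ (circlePoint e f a) (z : EuclideanSpace ℝ (Fin d)) *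
        inner ℝ (circlePoint e f b) (z : EuclideanSpace ℝ (Fin d)) < 0} :=
    measurableSet_lt (by fun_prop) (by fun_prop)
  have hcomb' : ∀ z : EuclideanSpace ℝ (Fin d), inner ℝ e z * inner ℝ (circlePoint e f a) z < 0 →
      ¬ inner ℝ (circlePoint e f a) z * inner ℝ (circlePoint e f b) z < 0 := by
    intro z h1 h2
    rcases hb.lt_or_eq with hb' | rfl
    -- The point at `a` is a nonnegative combination of the other two, so it cannot lie strictly on
    -- the opposite side from both. The cases `b = π` and `b = 0`, where `sin b = 0`, are treated
    -- apart.
    · have hsin : Real.sin b • circlePoint e f a =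
          Real.sin (b - a) • e + Real.sin a • circlePoint e f b := by
        simp only [circlePoint, Real.sin_sub]
        module
      have hinner := congrArg (fun w => inner ℝ (circlePoint e f a) z * inner ℝ w z) hsin
      simp only [inner_add_left, real_inner_smul_left] at hinner
      rcases (ha.trans hab).lt_or_eq with hb0 | rfl
      · have s1 := Real.sin_pos_of_pos_of_lt_pi hb0 hb'
        have s2 := Real.sin_nonneg_of_nonneg_of_le_pi (x := b - a) (by linarith) (by linarith)
        have s3 := Real.sin_nonneg_of_nonneg_of_le_pi (x := a) ha (by linarith)
        have hne0 : inner ℝ (circlePoint e f a) z ≠ 0 := left_ne_zero_of_mul h2.ne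
        have := mul_pos s1 (mul_self_pos.2 hne0)
        nlinarith [mul_nonneg s2 (neg_nonneg.2 h1.le), mul_nonneg s3 (neg_nonneg.2 h2.le)]
      · rw [le_antisymm hab ha, circlePoint_zero] at h1
        exact absurd h1 (not_lt.2 (mul_self_nonneg _))
    · rw [circlePoint_pi, inner_neg_left] at h2
      linarith
  rw [← measureReal_union _ hmeas]
  · refine measureReal_congr (Filter.eventuallyEq_set.2 ?_)
    filter_upwards [ae_inner_ne_zero (hne 0), ae_inner_ne_zero (hne a),
      ae_inner_ne_zero (hne b)] with z h0 h1 h2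
    rw [circlePoint_zero] at h0
    simp only [Set.mem_ofPred_eq, Set.mem_union]
    constructor
    · intro h
      by_contra! hcon
      nlinarith [mul_nonneg hcon.1 hcon.2, mul_self_pos.2 h1]
    · intro h
      by_contra! hcon
      have h02 := lt_of_le_of_ne hcon (mul_ne_zero h0 h2).symm
      have h4 := mul_pos h02 (mul_self_pos.2 h1)
      rcases h with h | h
      · refine hcomb' z h ?_
        by_contra! hcon
        nlinarith [mul_nonpos_of_nonpos_of_nonneg h.le hcon]
      · refine hcomb' z ?_ h
        by_contra! hcon
        nlinarith [mul_nonpos_of_nonneg_of_nonpos hcon h.le]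
  · refine Set.disjoint_left.2 fun z h1 h2 => ?_
    simp only [Set.mem_ofPred_eq] at h1 h2
    exact hcomb' z h1 h2

end circlePoint

/-- A nonnegative additive function on an interval is linear. -/
theorem eq_div_mul_of_additive_nonneg {g : ℝ → ℝ} {T : ℝ} (hT : 0 < T)
    (hg : ∀ t, 0 ≤ t → t ≤ T → 0 ≤ g t)
    (hadd : ∀ a b, 0 ≤ a → a ≤ b → b ≤ T → g b = g a + g (b - a)) {t : ℝ} (ht0 : 0 ≤ t)
    (htT : t ≤ T) : g t = t / T * g T := by
  -- The deviation from linearity doubles with `t`, so a bound on `[0, T]` is halved on `[0, T /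
  -- 2]`. It changes sign under `t ↦ T - t`, which covers the other half.
  have key : ∀ n : ℕ, ∀ t, 0 ≤ t → t ≤ T → |g t - t / T * g T| ≤ g T / 2 ^ n := by
    have hsmall : ∀ B : ℝ, (∀ t, 0 ≤ t → t ≤ T → |g t - t / T * g T| ≤ B) →
        ∀ t, 0 ≤ t → t ≤ T / 2 → |g t - t / T * g T| ≤ B / 2 := by
      intro B hB t h0 h1
      have h2 := hB (2 * t) (by linarith) (by linarith)
      rw [hadd t (2 * t) h0 (by linarith) (by linarith), show 2 * t - t = t by ring,
        show g t + g t - 2 * t / T * g T = 2 * (g t - t / T * g T) by ring, abs_mul, abs_two] at h2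
      linarith
    intro n
    induction n with
    | zero =>
      intro t h0 h1
      have h2 := hadd t T h0 h1 le_rfl
      have h3 := hg t h0 h1
      have h4 := hg (T - t) (by linarith) (by linarith)
      have h5 : 0 ≤ t / T * g T := mul_nonneg (by positivity) (by linarith)
      have h6 : t / T * g T ≤ g T :=
        mul_le_of_le_one_left (by linarith) ((div_le_one hT).2 h1)
      rw [abs_le, pow_zero, div_one]
      constructor <;> linarith
    | succ n ih =>
      intro t h0 h1
      rw [pow_succ, ← div_div]
      rcases le_total t (T / 2) with h | h
      · exact hsmall _ ih t h0 h
      · have h2 := hsmall _ ih (T - t) (by linarith) (by linarith)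
        have h3 : g (T - t) - (T - t) / T * g T = -(g t - t / T * g T) := by
          rw [sub_div, div_self hT.ne', one_sub_mul]
          linarith [hadd t T h0 h1 le_rfl]
        rwa [h3, abs_neg] at h2
  have hlim : Filter.Tendsto (fun n : ℕ => g T / 2 ^ n) Filter.atTop (nhds 0) :=
    tendsto_const_nhds.div_atTop (tendsto_pow_atTop_atTop_of_one_lt one_lt_two)
  have := ge_of_tendsto' hlim fun n => key n t ht0 htT
  exact sub_eq_zero.1 (abs_nonpos_iff.1 this)

theorem separationProb_circlePoint {d : ℕ} [NeZero d] {e f : EuclideanSpace ℝ (Fin d)}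
    (he : ‖e‖ = 1) (hf : ‖f‖ = 1) (hef : inner ℝ e f = 0) {t : ℝ} (ht0 : 0 ≤ t)
    (ht : t ≤ Real.pi) : separationProb e (circlePoint e f t) = t / Real.pi := by
  have hne : e ≠ 0 := norm_ne_zero_iff.1 (by rw [he]; exact one_ne_zero)
  rw [eq_div_mul_of_additive_nonneg (g := fun t => separationProb e (circlePoint e f t))
    Real.pi_pos (fun _ _ _ => measureReal_nonneg)
    (fun a b h0 h1 h2 => separationProb_circlePoint_add he hf hef h0 h1 h2) ht0 ht]
  simp only [circlePoint_pi]
  rw [separationProb_neg hne, mul_one]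

theorem separationProb_eq {d : ℕ} [NeZero d] {x y : EuclideanSpace ℝ (Fin d)} (hx : x ≠ 0)
    (hy : y ≠ 0) : separationProb x y = InnerProductGeometry.angle x y / Real.pi := by
  have hx' : 0 < ‖x‖ := norm_pos_iff.2 hx
  have hy' : 0 < ‖y‖ := norm_pos_iff.2 hy
  set θ := InnerProductGeometry.angle x y with hθ
  -- Parallel vectors span no plane; otherwise `sin θ > 0` and Gram–Schmidt yields `f`.
  by_cases h0 : θ = 0
  · obtain ⟨-, r, hr, rfl⟩ := InnerProductGeometry.angle_eq_zero_iff.1 h0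
    have := separationProb_smul x x one_pos hr
    rw [one_smul, separationProb_self] at this
    rw [this, h0, zero_div]
  by_cases hπ : θ = Real.pi
  · obtain ⟨-, r, hr, rfl⟩ := InnerProductGeometry.angle_eq_pi_iff.1 hπ
    have := separationProb_smul x (-x) one_pos (neg_pos.2 hr)
    rw [one_smul, neg_smul_neg, separationProb_neg hx] at this
    rw [this, hπ, div_self Real.pi_ne_zero]
  have hθ0 : 0 ≤ θ := InnerProductGeometry.angle_nonneg x y
  have hθπ : θ ≤ Real.pi := InnerProductGeometry.angle_le_pi x y
  have hsin : 0 < Real.sin θ :=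
    Real.sin_pos_of_pos_of_lt_pi (lt_of_le_of_ne hθ0 (Ne.symm h0)) (lt_of_le_of_ne hθπ hπ)
  set e := ‖x‖⁻¹ • x with he
  set u := ‖y‖⁻¹ • y with hu
  have he1 : ‖e‖ = 1 := by simp [he, norm_smul, hx'.ne']
  have hu1 : ‖u‖ = 1 := by simp [hu, norm_smul, hy'.ne']
  have heu : inner ℝ e u = Real.cos θ := by
    rw [hθ, InnerProductGeometry.cos_angle, he, hu, real_inner_smul_left, real_inner_smul_right]
    field_simp
  set f := (Real.sin θ)⁻¹ • (u - Real.cos θ • e) with hf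
  have hef : inner ℝ e f = 0 := by
    rw [hf, real_inner_smul_right, inner_sub_right, heu, real_inner_smul_right,
      real_inner_self_eq_norm_sq, he1]
    ring
  have huf : circlePoint e f θ = u := by
    rw [circlePoint, hf, smul_inv_smul₀ hsin.ne', add_sub_cancel]
  have hf1 : ‖f‖ = 1 := by
    have h1 : ‖u - Real.cos θ • e‖ ^ 2 = Real.sin θ ^ 2 := by
      rw [norm_sub_sq_real, real_inner_smul_right, real_inner_comm, heu, hu1, norm_smul, he1,
        mul_one, Real.norm_eq_abs, sq_abs, Real.sin_sq]
      ring
    have h2 : ‖u - Real.cos θ • e‖ = Real.sin θ :=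
      (pow_left_inj₀ (norm_nonneg _) hsin.le two_ne_zero).1 h1
    rw [hf, norm_smul, h2, norm_inv, Real.norm_of_nonneg hsin.le, inv_mul_cancel₀ hsin.ne']
  rw [← separationProb_circlePoint he1 hf1 hef hθ0 hθπ, huf, he, hu,
    separationProb_smul x y (inv_pos.2 hx') (inv_pos.2 hy')]

/-- Two nonzero vectors have the same SimHash value with probability equal to their angular
similarity. -/
theorem sphereUniform_simHash_eq {d : ℕ} [NeZero d] {x y : EuclideanSpace ℝ (Fin d)}
    (hx : x ≠ 0) (hy : y ≠ 0) :
    (sphereUniform d).real {z | simHash z x = simHash z y} = angularSim x y := by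
  have hmeas : MeasurableSet {z : Metric.sphere (0 : EuclideanSpace ℝ (Fin d)) 1 |
      inner ℝ x (z : EuclideanSpace ℝ (Fin d)) * inner ℝ y (z : EuclideanSpace ℝ (Fin d)) < 0} :=
    measurableSet_lt (by fun_prop) (by fun_prop)
  rw [angularSim, ← separationProb_eq hx hy, separationProb, ← probReal_compl_eq_one_sub hmeas]
  refine measureReal_congr (Filter.eventuallyEq_set.2 ?_)
  -- Off a null set neither sign is `0`, so the signs differ iff the product is negative.
  filter_upwards [ae_inner_ne_zero hx, ae_inner_ne_zero hy] with z h1 h2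
  simp only [Set.mem_ofPred_eq, Set.mem_compl_iff, simHash]
  rcases lt_or_gt_of_ne h1 with h1 | h1 <;> rcases lt_or_gt_of_ne h2 with h2 | h2 <;>
    simp [h1, h2, sign_neg, sign_pos, mul_pos_of_neg_of_neg, mul_neg_of_neg_of_pos,
      mul_neg_of_pos_of_neg, le_of_lt]

theorem mainTheorem3 (ε₀ : ℝ) (hε₀ : ε₀ < 1) :
    ∃ C : ℝ, 0 < C ∧ ∀ ε : ℝ, 0 < ε → ε ≤ ε₀ → ∀ M : ℝ, 1 ≤ M →
      -- angular similarity and SimHash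
      (∀ (d : ℕ) [NeZero d] (P : Finset (EuclideanSpace ℝ (Fin d))), 0 ∉ P →
        ∀ π : P → Fin P.card ≃ P, IsNNOrdering P angularSim π →
        ∀ (k : ℕ) (_ : 1 ≤ k) (_ : k ≤ P.card),
          IsANNFamily (sphereUniform d) simHash P π k (C * ε) (4 * M * Real.log P.card)
            (approxNeighbors P angularSim π ⟨k - 1, by omega⟩ ε M)) ∧
      -- Jaccard similarity and MinHash
      (∀ (𝒰 : Type*) [DecidableEq 𝒰] (P : Finset (Finset 𝒰)), ∅ ∉ P →
        ∀ π : P → Fin P.card ≃ P, IsNNOrdering P jaccardSim π →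
        ∀ (k : ℕ) (_ : 1 ≤ k) (_ : k ≤ P.card),
          IsANNFamily (uniformLabels 𝒰) minHash P π k (C * ε) (4 * M * Real.log P.card)
            (approxNeighbors P jaccardSim π ⟨k - 1, by omega⟩ ε M)) := by
  -- The constant is the one from `rpow_le_pow_floor`.
  refine ⟨4 / (1 - ε₀), div_pos (by norm_num) (by linarith), fun ε hε hle M hM => ⟨?_, ?_⟩⟩
  · intro d _ P h0 π hπ k hk1 hk
    refine isANNFamily_approxNeighbors _ _ _ _ (fun p hp q hq => ?_) π hπ _ ?_ hε₀ hε hle hM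
    · exact sphereUniform_simHash_eq (ne_of_mem_of_not_mem hp h0) (ne_of_mem_of_not_mem hq h0)
    · exact Nat.sub_add_cancel hk1
  · intro 𝒰 _ P h0 π hπ k hk1 hk
    refine isANNFamily_approxNeighbors _ _ _ _ (fun p hp q hq => ?_) π hπ _ ?_ hε₀ hε hle hM
    · exact uniformLabels_minHash_eq
        (Finset.nonempty_iff_ne_empty.2 (ne_of_mem_of_not_mem hp h0))
        (Finset.nonempty_iff_ne_empty.2 (ne_of_mem_of_not_mem hq h0))
    · exact Nat.sub_add_cancel hk1
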